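/- Let $F$ be a field of characteristic $2$, let $V$ be an infinite-dimensional vector space over $F$, let $\alpha \in F$, and let $u$ be a finite-rank endomorphism of $V$ whose trace belongs to $\{0,\alpha\}$. (The trace of a finite-rank endomorphism $u$ is the trace of the endomorphism of the finite-dimensional space $\operatorname{Im} u$ induced by $u$; equivalently, of the endomorphism induced by $u$ on any finite-dimensional subspace containing $\operatorname{Im} u$.) Then $\alpha\,\mathrm{id}_V + u$ is the sum of three square-zero endomorphisms of $V$, i.e. there are endomorphisms $a, b, c$ of $V$ with $a^2 = b^2 = c^2 = 0$ and $\alpha\,\mathrm{id}_V + u = a + b + c$. -/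

import Mathlib

/-- The trace of an endomorphism `u` of finite rank of a vector space that may be
infinite-dimensional: the trace of the endomorphism of the (finite-dimensional) range of `u`
induced by `u`. -/
noncomputable def finiteRankTrace {F V : Type*} [Field F] [AddCommGroup V] [Module F V]
    (u : Module.End F V) : F :=
  LinearMap.trace F (LinearMap.range u)
    (u.restrict (p := LinearMap.range u) (q := LinearMap.range u)
      (fun x _ => LinearMap.mem_range_self u x))

/-- The trace of a finite-rank endomorphism `u` may be computed on any finite-dimensional subspace
that contains the range of `u`. -/
theorem finiteRankTrace_eq_trace_restrict {F V : Type*} [Field F] [AddCommGroup V] [Module F V]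
    (u : Module.End F V) (W : Submodule F V) [FiniteDimensional F W]
    (hW : LinearMap.range u ≤ W) :
    finiteRankTrace u =
      LinearMap.trace F W
        (u.restrict (p := W) (q := W) (fun x _ => hW (LinearMap.mem_range_self u x))) := by
  have : FiniteDimensional F (LinearMap.range u) := Submodule.finiteDimensional_of_le hW
  exact LinearMap.trace_comp_comm' (Submodule.inclusion hW) (u.rangeRestrict ∘ₗ W.subtype)

/-! Suppose a basis is split in two classes so that both diagonal blocks of the matrix of `u` are
diagonal. If the nonzero diagonal entries of `α • id + u` can be paired, equal with equal across the
classes, then in characteristic 2 a square-zero `c` sending both vectors of a pair with entry `ν` to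
`ν` times their sum removes the diagonal. What remains exchanges the classes and is a sum of two
square-zero operators (`exists_three_sq_zero`).

To find such a basis, write `u` as a finite-dimensional operator plus zero on an
infinite-dimensional `Z`, and split the former into cyclic blocks with traces `d i`. With two extra
zero dimensions, each block has such a basis whose diagonal is zero except for one entry in each
class, `x i` and `y i`, subject to `x i + y i = d i` and freely chosen when `d i ≠ 0`
(`exists_hasDiagonalBlocks_of_cyclic`). Taking consecutive partial sums of the traces makes all
multiplicities agree, except perhaps those of `0` and of the total trace, which is `0` or `α`. The
entry `0` is balanced by `Z`; the entry `α` of `u` becomes `α + α = 0` and needs no partner. -/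

open Module Polynomial

/-- A basis split in two classes by `χ` such that the two diagonal blocks of the matrix of `u`
are diagonal, with diagonal entries given by `μ`. -/
def IsBlockDiagonalBasis {F V ι : Type*} [Field F] [AddCommGroup V] [Module F V]
    (u : Module.End F V) (b : Basis ι F V) (χ : ι → Bool) (μ : ι → F) : Prop :=
  ∀ i, u (b i) - μ i • b i ∈ Submodule.span F (b '' {j | χ j ≠ χ i})

/-- `u` has a finite basis in which the two diagonal blocks of its matrix are diagonal, with all
entries zero but possibly an entry `x` in the first block and an entry `y` in the second. -/
def HasDiagonalBlocks {F V : Type*} [Field F] [AddCommGroup V] [Module F V]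
    (u : Module.End F V) (x y : F) : Prop :=
  ∃ (n : ℕ) (b : Basis (Fin n) F V) (χ : Fin n → Bool) (μ : Fin n → F) (k l : Fin n),
    IsBlockDiagonalBasis u b χ μ ∧ χ k = true ∧ χ l = false ∧ μ k = x ∧ μ l = y ∧
      ∀ j, j ≠ k → j ≠ l → μ j = 0

/-! ### Split bases and sums of square-zero operators. -/

section BlockDiagonalBasis

variable {F V V' ι ι' : Type*} [Field F] [AddCommGroup V] [Module F V] [AddCommGroup V']
  [Module F V']

theorem IsBlockDiagonalBasis.map {u : Module.End F V} {b : Basis ι F V} {χ : ι → Bool} {μ : ι → F}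
    (h : IsBlockDiagonalBasis u b χ μ) (e : V ≃ₗ[F] V') (u' : Module.End F V')
    (hu : ∀ v, u' (e v) = e (u v)) : IsBlockDiagonalBasis u' (b.map e) χ μ := by
  intro i
  have := Submodule.mem_map_of_mem (f := (e : V →ₗ[F] V')) (h i)
  rw [Submodule.map_span, ← Set.image_comp] at this
  have h2 : ⇑(b.map e) = (e : V →ₗ[F] V') ∘ b := funext (b.map_apply e)
  rw [h2]
  convert this using 1
  simp [hu]

theorem IsBlockDiagonalBasis.reindex {u : Module.End F V} {b : Basis ι F V} {χ : ι → Bool}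
    {μ : ι → F} (h : IsBlockDiagonalBasis u b χ μ) (e : ι ≃ ι') :
    IsBlockDiagonalBasis u (b.reindex e) (χ ∘ e.symm) (μ ∘ e.symm) := by
  intro i
  have := h (e.symm i)
  simp only [Basis.reindex_apply, Function.comp_apply]
  refine Submodule.span_mono ?_ this
  rintro _ ⟨j, hj, rfl⟩
  exact ⟨e j, by simpa using hj, by simp⟩

theorem IsBlockDiagonalBasis.not {u : Module.End F V} {b : Basis ι F V} {χ : ι → Bool}
    {μ : ι → F} (h : IsBlockDiagonalBasis u b χ μ) :
    IsBlockDiagonalBasis u b (fun i => !χ i) μ := by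
  intro i
  simpa using h i

theorem IsBlockDiagonalBasis.prodMap {u : Module.End F V} {b : Basis ι F V} {χ : ι → Bool}
    {μ : ι → F} (h : IsBlockDiagonalBasis u b χ μ) {u' : Module.End F V'} {b' : Basis ι' F V'}
    {χ' : ι' → Bool} {μ' : ι' → F} (h' : IsBlockDiagonalBasis u' b' χ' μ') :
    IsBlockDiagonalBasis (LinearMap.prodMap u u') (b.prod b') (Sum.elim χ χ') (Sum.elim μ μ') := by
  rintro (i | i)
  · have := Submodule.mem_map_of_mem (f := LinearMap.inl F V V') (h i)
    rw [Submodule.map_span, ← Set.image_comp] at this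
    have h2 : (LinearMap.prodMap u u') (b.prod b' (Sum.inl i)) -
        Sum.elim μ μ' (Sum.inl i) • b.prod b' (Sum.inl i) =
        LinearMap.inl F V V' (u (b i) - μ i • b i) := by
      ext <;> simp
    rw [h2]
    refine Submodule.span_mono ?_ this
    rintro _ ⟨j, hj, rfl⟩
    exact ⟨Sum.inl j, by simpa using hj, by ext <;> simp⟩
  · have := Submodule.mem_map_of_mem (f := LinearMap.inr F V V') (h' i)
    rw [Submodule.map_span, ← Set.image_comp] at this
    have h2 : (LinearMap.prodMap u u') (b.prod b' (Sum.inr i)) -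
        Sum.elim μ μ' (Sum.inr i) • b.prod b' (Sum.inr i) =
        LinearMap.inr F V V' (u' (b' i) - μ' i • b' i) := by
      ext <;> simp
    rw [h2]
    refine Submodule.span_mono ?_ this
    rintro _ ⟨j, hj, rfl⟩
    exact ⟨Sum.inr j, by simpa using hj, by ext <;> simp⟩

theorem IsBlockDiagonalBasis.pi {η : Type*} [Fintype η] {M : η → Type*} {κ : η → Type*}
    [∀ i, AddCommGroup (M i)] [∀ i, Module F (M i)] {u : ∀ i, Module.End F (M i)}
    {b : ∀ i, Basis (κ i) F (M i)} {χ : ∀ i, κ i → Bool} {μ : ∀ i, κ i → F}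
    (h : ∀ i, IsBlockDiagonalBasis (u i) (b i) (χ i) (μ i)) :
    IsBlockDiagonalBasis (LinearMap.pi fun i => u i ∘ₗ LinearMap.proj i) (Pi.basis b)
      (fun p => χ p.1 p.2) (fun p => μ p.1 p.2) := by
  classical
  rintro ⟨i, j⟩
  have := Submodule.mem_map_of_mem (f := LinearMap.single F M i) (h i j)
  rw [Submodule.map_span, ← Set.image_comp] at this
  have h2 : (LinearMap.pi fun i => u i ∘ₗ LinearMap.proj i) (Pi.basis b ⟨i, j⟩) -
      μ i j • Pi.basis b ⟨i, j⟩ = LinearMap.single F M i (u i (b i j) - μ i j • b i j) := by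
    rw [Pi.basis_apply]
    ext k
    by_cases hk : k = i
    · subst hk
      simp
    · simp [hk]
  simp only
  rw [h2]
  refine Submodule.span_mono ?_ this
  rintro _ ⟨j', hj, rfl⟩
  exact ⟨⟨i, j'⟩, by simpa using hj, by simp [Pi.basis_apply]⟩

theorem isBlockDiagonalBasis_zero (b : Basis ι F V) (χ : ι → Bool) :
    IsBlockDiagonalBasis (0 : Module.End F V) b χ 0 := by
  intro i
  simp

/-- An operator that exchanges the spans of the two classes of a basis is a sum of two square-zero
operators. -/
theorem exists_sq_zero_add_sq_zero {B : Module.End F V} {b : Basis ι F V} {χ : ι → Bool}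
    (h : IsBlockDiagonalBasis B b χ 0) :
    ∃ a a' : Module.End F V, a ^ 2 = 0 ∧ a' ^ 2 = 0 ∧ B = a + a' := by
  -- `B` sends class `t` into the span of the other class, which the truncation of `B` to class `t`
  -- kills.
  have key : ∀ t : Bool, (b.constr F fun i => if χ i = t then B (b i) else 0) ^ 2 = 0 := by
    intro t
    refine b.ext fun i => ?_
    rw [pow_two, Module.End.mul_apply, Basis.constr_basis, LinearMap.zero_apply]
    split_ifs with hi
    · have h1 := h i
      simp only [Pi.zero_apply, zero_smul, sub_zero] at h1
      have h2 : Submodule.span F (b '' {j | χ j ≠ χ i}) ≤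
          LinearMap.ker (b.constr F fun i => if χ i = t then B (b i) else 0) := by
        rw [Submodule.span_le]
        rintro _ ⟨j, hj, rfl⟩
        have hj' : ¬ χ j = t := fun h => hj (h.trans hi.symm)
        simp [Basis.constr_basis, hj']
      exact h2 h1
    · simp
  refine ⟨_, _, key true, key false, b.ext fun i => ?_⟩
  simp only [LinearMap.add_apply, Basis.constr_basis]
  cases χ i <;> simp

theorem exists_three_sq_zero [CharP F 2] {A : Module.End F V} {b : Basis ι F V} {χ : ι → Bool}
    {ν : ι → F} (h : IsBlockDiagonalBasis A b χ ν) (τ : ι → ι) (hτ : ∀ i, τ (τ i) = i)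
    (hν : ∀ i, ν (τ i) = ν i) (hχ : ∀ i, ν i ≠ 0 → χ (τ i) ≠ χ i) :
    ∃ a a' c : Module.End F V, a ^ 2 = 0 ∧ a' ^ 2 = 0 ∧ c ^ 2 = 0 ∧ A = a + a' + c := by
  have two : ∀ v : V, v + v = 0 := fun v => by
    rw [← two_smul F v, CharTwo.two_eq_zero, zero_smul]
  set c : Module.End F V := b.constr F fun i => ν i • (b i + b (τ i)) with hc
  have hcb : ∀ i, c (b i) = ν i • (b i + b (τ i)) := fun i => by rw [hc, Basis.constr_basis]
  have hc2 : c ^ 2 = 0 := by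
    refine b.ext fun i => ?_
    rw [pow_two, Module.End.mul_apply, hcb, map_smul, map_add, hcb, hcb, hτ, hν,
      add_comm (b (τ i)), two, smul_zero, LinearMap.zero_apply]
  have hB : IsBlockDiagonalBasis (A - c) b χ 0 := by
    intro i
    have h1 : (A - c) (b i) - (0 : ι → F) i • b i =
        (A (b i) - ν i • b i) - ν i • b (τ i) := by
      simp [hcb]
      abel
    rw [h1]
    refine sub_mem (h i) ?_
    by_cases h0 : ν i = 0
    · simp [h0]
    · exact Submodule.smul_mem _ _ (Submodule.subset_span ⟨τ i, hχ i h0, rfl⟩)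
  obtain ⟨a, a', ha, ha', haa⟩ := exists_sq_zero_add_sq_zero hB
  exact ⟨a, a', c, ha, ha', hc2, by rw [← haa]; abel⟩

/-- If all the diagonal entries but those equal to `α` occur equally often in both diagonal blocks,
then `α • id + u` is a sum of three square-zero operators. -/
theorem exists_three_sq_zero_of_equiv [CharP F 2] {u : Module.End F V} {b : Basis ι F V}
    {χ : ι → Bool} {μ : ι → F} (h : IsBlockDiagonalBasis u b χ μ) (α : F)
    (he : ∀ c ≠ α, Nonempty ({i // χ i = true ∧ μ i = c} ≃ {i // χ i = false ∧ μ i = c})) :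
    ∃ a a' c : Module.End F V, a ^ 2 = 0 ∧ a' ^ 2 = 0 ∧ c ^ 2 = 0 ∧
      α • LinearMap.id + u = a + a' + c := by
  classical
  have e := fun c hc => (he c hc).some
  have hA : IsBlockDiagonalBasis (α • LinearMap.id + u) b χ (fun i => α + μ i) := by
    intro i
    convert h i using 1
    simp [add_smul]
  -- Indices with `μ i = α` may be fixed: there `α + μ i = 0`.
  let τ : ι → ι := fun i =>
    if h0 : μ i = α then i else
      if h1 : χ i = true then (e (μ i) h0 ⟨i, h1, rfl⟩ : ι)
      else ((e (μ i) h0).symm ⟨i, by simpa using h1, rfl⟩ : ι)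
  have hτ0 : ∀ i, μ i = α → τ i = i := fun i hi => by simp [τ, hi]
  have hτ1 : ∀ c (hc : c ≠ α) i (hi : χ i = true ∧ μ i = c), τ i = (e c hc ⟨i, hi⟩ : ι) := by
    rintro c hc i ⟨h1, rfl⟩
    simp [τ, hc, h1]
  have hτ2 : ∀ c (hc : c ≠ α) i (hi : χ i = false ∧ μ i = c),
      τ i = ((e c hc).symm ⟨i, hi⟩ : ι) := by
    rintro c hc i ⟨h1, rfl⟩
    simp [τ, hc, h1]
  refine exists_three_sq_zero hA τ ?_ ?_ ?_
  · intro i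
    by_cases h0 : μ i = α
    · rw [hτ0 i h0, hτ0 i h0]
    · cases h1 : χ i
      · rw [hτ2 _ h0 i ⟨h1, rfl⟩, hτ1 _ h0 _ (Subtype.prop ((e (μ i) h0).symm _))]
        simp
      · rw [hτ1 _ h0 i ⟨h1, rfl⟩, hτ2 _ h0 _ (Subtype.prop ((e (μ i) h0) _))]
        simp
  · intro i
    by_cases h0 : μ i = α
    · rw [hτ0 i h0]
    · cases h1 : χ i
      · rw [hτ2 _ h0 i ⟨h1, rfl⟩, (Subtype.prop ((e (μ i) h0).symm _)).2]
      · rw [hτ1 _ h0 i ⟨h1, rfl⟩, (Subtype.prop ((e (μ i) h0) _)).2]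
  · intro i hi
    have h0 : μ i ≠ α := by
      rintro h0
      exact hi (by rw [h0, CharTwo.add_self_eq_zero])
    cases h1 : χ i
    · rw [hτ2 _ h0 i ⟨h1, rfl⟩, (Subtype.prop ((e (μ i) h0).symm _)).1]
      simp
    · rw [hτ1 _ h0 i ⟨h1, rfl⟩, (Subtype.prop ((e (μ i) h0) _)).1]
      simp

end BlockDiagonalBasis

/-! ### Prescribing the two diagonal entries of a cyclic block. -/

section DiagonalBlocks

variable {F V V' ι : Type*} [Field F] [AddCommGroup V] [Module F V] [AddCommGroup V'] [Module F V']

theorem IsBlockDiagonalBasis.hasDiagonalBlocks [Finite ι] {u : Module.End F V} {b : Basis ι F V}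
    {χ : ι → Bool} {μ : ι → F} (h : IsBlockDiagonalBasis u b χ μ) (k l : ι) (hk : χ k = true)
    (hl : χ l = false) (hμ : ∀ j, j ≠ k → j ≠ l → μ j = 0) : HasDiagonalBlocks u (μ k) (μ l) := by
  let e := Finite.equivFin ι
  refine ⟨_, b.reindex e, _, _, e k, e l, h.reindex e, by simpa, by simpa, by simp, by simp, ?_⟩
  intro j hj hj'
  refine hμ _ ?_ ?_
  · rintro rfl
    simp at hj
  · rintro rfl
    simp at hj'

theorem HasDiagonalBlocks.symm {u : Module.End F V} {x y : F} (h : HasDiagonalBlocks u x y) :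
    HasDiagonalBlocks u y x := by
  obtain ⟨n, b, χ, μ, k, l, hb, hk, hl, hx, hy, h0⟩ := h
  exact ⟨n, b, _, μ, l, k, hb.not, by simpa, by simpa, hy, hx, fun j h1 h2 => h0 j h2 h1⟩

theorem HasDiagonalBlocks.map {u : Module.End F V} {x y : F} (h : HasDiagonalBlocks u x y)
    (e : V ≃ₗ[F] V') (u' : Module.End F V') (hu : ∀ v, u' (e v) = e (u v)) :
    HasDiagonalBlocks u' x y := by
  obtain ⟨n, b, χ, μ, k, l, hb, h⟩ := h
  exact ⟨n, b.map e, χ, μ, k, l, hb.map e u' hu, h⟩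

theorem HasDiagonalBlocks.prodMap_zero [FiniteDimensional F V'] {u : Module.End F V} {x y : F}
    (h : HasDiagonalBlocks u x y) :
    HasDiagonalBlocks (LinearMap.prodMap u (0 : Module.End F V')) x y := by
  obtain ⟨n, b, χ, μ, k, l, hb, hk, hl, rfl, rfl, h0⟩ := h
  have hb' := hb.prodMap (isBlockDiagonalBasis_zero (finBasis F V') fun _ => true)
  refine hb'.hasDiagonalBlocks (Sum.inl k) (Sum.inl l) hk hl ?_
  rintro (j | j) h1 h2
  · exact h0 j (by simpa using h1) (by simpa using h2)
  · rfl

theorem hasDiagonalBlocks_zero [FiniteDimensional F V] (h : 2 ≤ finrank F V) :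
    HasDiagonalBlocks (0 : Module.End F V) 0 0 := by
  refine ⟨_, finBasis F V, fun i => decide (i.1 = 0), 0, ⟨0, by omega⟩, ⟨1, by omega⟩,
    isBlockDiagonalBasis_zero _ _, by simp, by simp, rfl, rfl, fun _ _ _ => rfl⟩

/-- A nonzero scalar operator on a line, extended by zero to a plane. -/
theorem hasDiagonalBlocks_of_smul {u : Module.End F V} {x y d : F} (b : Basis (Fin 1) F V)
    (hu : ∀ v, u v = d • v) (hd : d ≠ 0) (hxy : x + y = d) :
    HasDiagonalBlocks (LinearMap.prodMap u (0 : Module.End F F)) x y := by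
  -- The second vector is the image of the first under the operator minus `x`. The operator is
  -- annihilated by `X ^ 2 - d X`, so the operator minus `y` returns the second vector to `x * y`
  -- times the first.
  let g : Fin 2 → V × F := ![(b 0, 1), (y • b 0, -x)]
  have hg : ⊤ ≤ Submodule.span F (Set.range g) := by
    have h0 : g 0 ∈ Submodule.span F (Set.range g) := Submodule.subset_span ⟨0, rfl⟩
    have h1 : g 1 ∈ Submodule.span F (Set.range g) := Submodule.subset_span ⟨1, rfl⟩
    have e1 : ((b 0, 0) : V × F) = d⁻¹ • (x • g 0 + g 1) := by
      simp [g, ← add_smul, hxy, smul_smul, inv_mul_cancel₀ hd]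
    have e2 : ((0, 1) : V × F) = g 0 - (b 0, 0) := by simp [g]
    have m1 : ((b 0, 0) : V × F) ∈ Submodule.span F (Set.range g) := by
      rw [e1]
      exact Submodule.smul_mem _ _ (add_mem (Submodule.smul_mem _ _ h0) h1)
    have m2 : ((0, 1) : V × F) ∈ Submodule.span F (Set.range g) := by
      rw [e2]
      exact sub_mem h0 m1
    rintro ⟨v, t⟩ -
    have : ((v, t) : V × F) = b.repr v 0 • (b 0, 0) + t • (0, 1) := by
      have := b.sum_repr v
      simp only [Finset.univ_unique, Fin.default_eq_zero, Finset.sum_singleton] at this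
      simp [this]
    rw [this]
    exact add_mem (Submodule.smul_mem _ _ m1) (Submodule.smul_mem _ _ m2)
  have := b.finiteDimensional_of_finite
  have hcard : Fintype.card (Fin 2) = finrank F (V × F) := by
    simp [finrank_eq_card_basis b]
  let B := basisOfTopLeSpanOfCardEqFinrank g hg hcard
  have hB : ⇑B = g := coe_basisOfTopLeSpanOfCardEqFinrank g hg hcard
  have hblock : IsBlockDiagonalBasis (LinearMap.prodMap u (0 : Module.End F F)) B
      ![true, false] ![x, y] := by
    intro i
    rw [hB]
    fin_cases i
    · have : (LinearMap.prodMap u (0 : Module.End F F)) (g 0) - x • g 0 = g 1 := by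
        simp [g, hu, ← sub_smul, ← hxy]
      exact this ▸ Submodule.subset_span ⟨1, by simp, rfl⟩
    · have : (LinearMap.prodMap u (0 : Module.End F F)) (g 1) - y • g 1 = (x * y) • g 0 := by
        simp [g, hu, ← sub_smul, ← hxy, smul_smul]
        constructor
        · congr 1
          ring
        · ring
      exact this ▸ Submodule.smul_mem _ _ (Submodule.subset_span ⟨0, by simp, rfl⟩)
  refine hblock.hasDiagonalBlocks 0 1 rfl rfl ?_
  intro j h1 h2
  fin_cases j <;> simp at h1 h2

/-- A cyclic operator on a space of dimension at least two. -/
theorem hasDiagonalBlocks_of_cyclic_of_ne_zero {u : Module.End F V} {m : ℕ}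
    (b : Basis (Fin (m + 2)) F V)
    (hu : ∀ j (h : j + 1 < m + 2), u (b ⟨j, by omega⟩) = b ⟨j + 1, h⟩) {x y : F} (hy : y ≠ 0)
    (hxy : x + y = b.repr (u (b (Fin.last _))) (Fin.last _)) : HasDiagonalBlocks u x y := by
  classical
  set c := b.repr (u (b (Fin.last _))) with hc
  set l : Fin (m + 2) := Fin.last _ with hl
  set k : Fin (m + 2) := ⟨m, by omega⟩ with hk
  have hlv : l.1 = m + 1 := rfl
  -- Classes alternate along the chain. `R` is the part of `u (b l)` below `b l` lying in the class
  -- of `l`, hence the obstruction to a diagonal block; `Q` lies in the class of `k` and is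
  -- harmless.
  set R : V := ∑ j : Fin (m + 2), if j ≠ l ∧ (j.1 + m) % 2 = 1 then c j • b j else 0 with hR
  set Q : V := ∑ j : Fin (m + 2), if j ≠ l ∧ (j.1 + m) % 2 = 0 then c j • b j else 0 with hQ
  have hul : u (b l) = (x + y) • b l + R + Q := by
    rw [← b.sum_repr (u (b l)), ← hc, hxy, hR, hQ, add_assoc, ← Finset.sum_add_distrib,
      ← Finset.add_sum_erase _ _ (Finset.mem_univ l),
      ← Finset.add_sum_erase (f := fun j => _ + _) _ (Finset.mem_univ l)]
    simp only [ne_eq, not_true_eq_false, false_and, if_false, add_zero, zero_add]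
    congr 1
    refine Finset.sum_congr rfl fun j hj => ?_
    have hj : j ≠ l := by simpa using hj
    rcases Nat.mod_two_eq_zero_or_one (j.1 + m) with h | h <;> simp [hj, h]
  -- The term `- x • b k` splits the trace into `x` at `k` and `y` at `l`; since `y * y⁻¹ = 1`, the
  -- term `y⁻¹ • R` absorbs `R` into `y • g l`.
  set g : Fin (m + 2) → V := Function.update b l (b l - x • b k + y⁻¹ • R) with hg
  set χ : Fin (m + 2) → Bool := fun j => decide ((j.1 + m) % 2 = 0) with hχ
  have hgl : g l = b l - x • b k + y⁻¹ • R := by simp [hg]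
  have hgj : ∀ j, j ≠ l → g j = b j := fun j hj => by simp [hg, hj]
  have hkl : k ≠ l := by
    intro h
    have := congrArg Fin.val h
    simp [hk, hlv] at this
  have mem : ∀ (t : Bool) (j : Fin (m + 2)), j ≠ l → χ j = t →
      b j ∈ Submodule.span F (g '' {j | χ j = t}) := fun t j hj ht => by
    rw [← hgj j hj]
    exact Submodule.subset_span ⟨j, ht, rfl⟩
  have hRmem : R ∈ Submodule.span F (g '' {j | χ j = false}) := by
    refine Submodule.sum_mem _ fun j _ => ?_
    split_ifs with h
    · exact Submodule.smul_mem _ _ (mem false j h.1 (by simp [hχ, h.2]))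
    · exact zero_mem _
  have hQmem : Q ∈ Submodule.span F (g '' {j | χ j = true}) := by
    refine Submodule.sum_mem _ fun j _ => ?_
    split_ifs with h
    · exact Submodule.smul_mem _ _ (mem true j h.1 (by simp [hχ, h.2]))
    · exact zero_mem _
  -- By parity `R` involves only indices below `m`, so `u` merely shifts it into the class of `k`.
  have huR : u R ∈ Submodule.span F (g '' {j | χ j = true}) := by
    rw [hR, map_sum]
    refine Submodule.sum_mem _ fun j _ => ?_
    split_ifs with h
    · have h1 : j.1 ≠ m + 1 := fun h' => h.1 (Fin.ext h')
      have h2 := j.2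
      have h3 : j.1 ≠ m := by
        intro h3
        have := h.2
        omega
      rw [map_smul]
      refine Submodule.smul_mem _ _ ?_
      have := hu j.1 (by omega)
      rw [Fin.eta] at this
      rw [this]
      refine mem true _ ?_ ?_
      · intro h'
        have := congrArg Fin.val h'
        simp only [hlv] at this
        omega
      · have := h.2
        simp only [hχ, decide_eq_true_eq]
        omega
    · simp
  have hspan : ⊤ ≤ Submodule.span F (Set.range g) := by
    rw [← b.span_eq, Submodule.span_le]
    rintro _ ⟨j, rfl⟩
    by_cases hj : j = l
    · have : b j = g l + x • g k - y⁻¹ • R := by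
        rw [hgl, hgj k hkl, hj]
        abel
      rw [this]
      exact sub_mem (add_mem (Submodule.subset_span ⟨_, rfl⟩)
        (Submodule.smul_mem _ _ (Submodule.subset_span ⟨_, rfl⟩)))
        (Submodule.smul_mem _ _ (Submodule.span_mono (Set.image_subset_range _ _) hRmem))
    · rw [← hgj j hj]
      exact Submodule.subset_span ⟨_, rfl⟩
  have hcard : Fintype.card (Fin (m + 2)) = finrank F V := (finrank_eq_card_basis b).symm
  let B := basisOfTopLeSpanOfCardEqFinrank g hspan hcard
  have hB : ⇑B = g := coe_basisOfTopLeSpanOfCardEqFinrank g hspan hcard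
  set μ : Fin (m + 2) → F := fun j => if j = l then y else if j = k then x else 0 with hμ
  have hblock : IsBlockDiagonalBasis u B χ μ := by
    intro i
    rw [hB]
    have hset : ∀ t : Bool, χ i = !t → {j | χ j ≠ χ i} = {j | χ j = t} := by
      intro t ht
      ext j
      rw [Set.mem_ofPred_eq, Set.mem_ofPred_eq, ht]
      cases χ j <;> cases t <;> simp
    by_cases hil : i = l
    · rw [hset true (by simp only [hil, hχ, hlv]; simp; omega)]
      have : u (g i) - μ i • g i = Q + y⁻¹ • u R + (y * x) • b k := by
        rw [hil, hgl]
        simp only [hμ, if_true, map_add, map_sub, map_smul, hul, hu m (by omega), hk]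
        have e1 : b ⟨m + 1, by omega⟩ = b l := rfl
        have e2 : y • y⁻¹ • R = R := by rw [smul_smul, mul_inv_cancel₀ hy, one_smul]
        rw [e1, smul_add, e2, smul_sub, add_smul, smul_smul]
        abel
      rw [this]
      refine add_mem (add_mem hQmem (Submodule.smul_mem _ _ huR))
        (Submodule.smul_mem _ _ (mem true k hkl ?_))
      simp only [hχ, hk, decide_eq_true_eq]
      omega
    · have h1 : i.1 ≠ m + 1 := fun h' => hil (Fin.ext h')
      have h2 := i.2
      have hui := hu i.1 (by omega)
      rw [Fin.eta] at hui
      rw [hgj i hil, hui]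
      by_cases hik : i = k
      · rw [hset false (by simp only [hik, hχ, hk]; simp; omega)]
        have : b ⟨i.1 + 1, by omega⟩ - μ i • b i = g l - y⁻¹ • R := by
          subst hik
          simp only [hμ, if_neg hkl, if_true, hgl]
          have e1 : b ⟨k.1 + 1, by omega⟩ = b l := rfl
          rw [e1]
          abel
        rw [this]
        refine sub_mem (Submodule.subset_span ⟨l, ?_, rfl⟩) (Submodule.smul_mem _ _ hRmem)
        simp only [hχ, Set.mem_ofPred_eq, hlv, decide_eq_false_iff_not]
        omega
      · have h3 : i.1 ≠ m := fun h' => hik (Fin.ext h')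
        have hnl : (⟨i.1 + 1, by omega⟩ : Fin (m + 2)) ≠ l := by
          intro h'
          have := congrArg Fin.val h'
          simp only [hlv] at this
          omega
        simp only [hμ, if_neg hil, if_neg hik, zero_smul, sub_zero]
        rw [← hgj _ hnl]
        refine Submodule.subset_span ⟨_, ?_, rfl⟩
        simp only [hχ, Set.mem_ofPred_eq, ne_eq, decide_eq_decide]
        omega
  have hfin := hblock.hasDiagonalBlocks k l (by simp only [hχ, hk, decide_eq_true_eq]; omega)
    (by simp only [hχ, hlv, decide_eq_false_iff_not]; omega) (fun j h1 h2 => by simp [hμ, h1, h2])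
  simpa [hμ, hkl] using hfin

theorem hasDiagonalBlocks_of_cyclic {u : Module.End F V} {m : ℕ} (b : Basis (Fin (m + 2)) F V)
    (hu : ∀ j (h : j + 1 < m + 2), u (b ⟨j, by omega⟩) = b ⟨j + 1, h⟩) {x y : F}
    (hne : x ≠ 0 ∨ y ≠ 0) (hxy : x + y = LinearMap.trace F V u) : HasDiagonalBlocks u x y := by
  have htr : LinearMap.trace F V u = b.repr (u (b (Fin.last _))) (Fin.last _) := by
    classical
    rw [LinearMap.trace_eq_matrix_trace F b, Matrix.trace, Fin.sum_univ_castSucc]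
    simp only [Matrix.diag_apply, LinearMap.toMatrix_apply]
    rw [Finset.sum_eq_zero, zero_add]
    intro j _
    have := hu j.1 (by omega)
    have e : Fin.castSucc j = ⟨j.1, by omega⟩ := rfl
    rw [e, this, Basis.repr_self, Finsupp.single_apply, if_neg]
    simp
  rw [htr] at hxy
  rcases hne with h | h
  · exact (hasDiagonalBlocks_of_cyclic_of_ne_zero b hu h (by rw [add_comm, hxy])).symm
  · exact hasDiagonalBlocks_of_cyclic_of_ne_zero b hu h hxy

/-- A cyclic operator, extended by zero to two more dimensions. -/
theorem exists_hasDiagonalBlocks_of_cyclic [CharP F 2] {u : Module.End F V} {n : ℕ}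
    (b : Basis (Fin n) F V)
    (hu : ∀ j (h : j + 1 < n), u (b ⟨j, by omega⟩) = b ⟨j + 1, h⟩) :
    ∃ w : F, ∀ x y : F, x + y = LinearMap.trace F V u →
      (LinearMap.trace F V u = 0 → x = w) →
      HasDiagonalBlocks (LinearMap.prodMap u (0 : Module.End F (F × F))) x y := by
  have := b.finiteDimensional_of_finite
  have zero : u = 0 → ∃ w : F, ∀ x y : F, x + y = LinearMap.trace F V u →
      (LinearMap.trace F V u = 0 → x = w) →
      HasDiagonalBlocks (LinearMap.prodMap u (0 : Module.End F (F × F))) x y := by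
    rintro rfl
    refine ⟨0, fun x y hxy hx => ?_⟩
    obtain rfl := hx (map_zero _)
    obtain rfl : y = 0 := by simpa using hxy
    rw [LinearMap.prodMap_zero]
    exact hasDiagonalBlocks_zero (by simp)
  match n, b, hu with
  | 0, b, _ =>
    exact zero (b.ext fun i => i.elim0)
  | 1, b, _ =>
    have hd : ∀ v, u v = LinearMap.trace F V u • v := by
      intro v
      have h1 : LinearMap.trace F V u = b.repr (u (b 0)) 0 := by
        classical
        simp [LinearMap.trace_eq_matrix_trace F b, Matrix.trace, LinearMap.toMatrix_apply]
      have h2 : u = LinearMap.trace F V u • LinearMap.id := by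
        refine b.ext fun i => ?_
        have := b.sum_repr (u (b 0))
        rw [Fin.sum_univ_one] at this
        rw [Subsingleton.elim i 0, h1, LinearMap.smul_apply, LinearMap.id_apply, this]
      exact LinearMap.congr_fun h2 v
    by_cases h0 : LinearMap.trace F V u = 0
    · exact zero (LinearMap.ext fun v => by rw [hd, h0, zero_smul, LinearMap.zero_apply])
    · refine ⟨0, fun x y hxy _ => ?_⟩
      refine (hasDiagonalBlocks_of_smul b hd h0 hxy).prodMap_zero (V' := F) |>.map
        (LinearEquiv.prodAssoc F V F F) _ ?_
      rintro ⟨⟨v, s⟩, t⟩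
      simp
      rfl
  | m + 2, b, hu =>
    -- For trace zero, `w = 1` makes `x` nonzero, as the cyclic construction must invert one of the
    -- two entries.
    refine ⟨1, fun x y hxy hx => (hasDiagonalBlocks_of_cyclic b hu ?_ hxy).prodMap_zero⟩
    by_contra! h
    rw [h.1, h.2, add_zero] at hxy
    have := hx hxy.symm
    rw [h.1] at this
    exact zero_ne_one this

end DiagonalBlocks

/-! ### Decomposition into cyclic blocks. -/

/-- This is the structure theorem for the torsion `F[X]`-module defined by `T`, with `X` acting as
`T`. -/
theorem exists_linearEquiv_pi_adjoinRoot {F : Type*} {W : Type*} [Field F] [AddCommGroup W]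
    [Module F W] [FiniteDimensional F W] (T : Module.End F W) :
    ∃ (m : ℕ) (f : Fin m → F[X]) (_ : ∀ i, f i ≠ 0) (e : W ≃ₗ[F] ∀ i, AdjoinRoot (f i)),
      ∀ w i, e (T w) i = AdjoinRoot.root (f i) * e w i := by
  classical
  have htor : Module.IsTorsion F[X] (AEval' T) := by
    intro w
    refine ⟨⟨minpoly F T, ?_⟩, ?_⟩
    · exact mem_nonZeroDivisors_of_ne_zero (minpoly.ne_zero (Algebra.IsIntegral.isIntegral T))
    · obtain ⟨w, rfl⟩ := (AEval'.of T).surjective w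
      change minpoly F T • AEval.of F W T w = 0
      rw [← AEval.of_aeval_smul, minpoly.aeval, zero_smul, map_zero]
  obtain ⟨ι, _, p, hp, n, ⟨e⟩⟩ := Module.equiv_directSum_of_isTorsion htor
  let σ := (Fintype.equivFin ι).symm
  let f : ι → F[X] := fun i => p i ^ n i
  let e2 : (AEval' T) ≃ₗ[F[X]] ∀ i, F[X] ⧸ Submodule.span F[X] {f i} :=
    e.trans (DirectSum.linearEquivFunOnFintype F[X] ι fun i => F[X] ⧸ Submodule.span F[X] {f i})
  let e3 : W ≃ₗ[F] ∀ i, AdjoinRoot (f i) := (AEval'.of T).trans (e2.restrictScalars F)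
  refine ⟨_, fun j => f (σ j), fun j => pow_ne_zero _ (hp _).ne_zero,
    e3.trans (LinearEquiv.piCongrLeft F (fun i => AdjoinRoot (f i)) σ).symm, ?_⟩
  intro w i
  have h1 : e2 (AEval'.of T (T w)) = (X : F[X]) • e2 (AEval'.of T w) := by
    rw [← map_smul, AEval'.X_smul_of]
  have h2 := congrFun h1 (σ i)
  change e2 (AEval'.of T (T w)) (σ i) = _ * e2 (AEval'.of T w) (σ i)
  rw [h2, Pi.smul_apply]
  obtain ⟨z, hz⟩ := Submodule.Quotient.mk_surjective _ (e2 (AEval'.of T w) (σ i))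
  rw [← hz, ← Submodule.Quotient.mk_smul]
  rfl

theorem AdjoinRoot.exists_basis_cyclic {F : Type*} [Field F] {f : F[X]} (hf : f ≠ 0) :
    ∃ b : Basis (Fin f.natDegree) F (AdjoinRoot f), ∀ j (h : j + 1 < f.natDegree),
      LinearMap.mulLeft F (AdjoinRoot.root f) (b ⟨j, by omega⟩) = b ⟨j + 1, h⟩ := by
  let b := (powerBasis hf).basis.reindex (finCongr (powerBasis_dim hf))
  have hb : ∀ i, b i = root f ^ i.1 := fun i => by
    rw [Basis.reindex_apply, PowerBasis.basis_eq_pow, powerBasis_gen]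
    rfl
  refine ⟨b, fun j h => ?_⟩
  rw [hb, hb, LinearMap.mulLeft_apply, pow_succ']

theorem LinearMap.trace_pi_comp_proj {F η : Type*} [Field F] [Fintype η] {M : η → Type*}
    [∀ i, AddCommGroup (M i)] [∀ i, Module F (M i)] [∀ i, FiniteDimensional F (M i)]
    (u : ∀ i, Module.End F (M i)) :
    LinearMap.trace F (∀ i, M i) (LinearMap.pi fun i => u i ∘ₗ LinearMap.proj i) =
      ∑ i, LinearMap.trace F (M i) (u i) := by
  classical
  rw [LinearMap.trace_eq_matrix_trace F (Pi.basis fun i => finBasis F (M i)), Matrix.trace,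
    Fintype.sum_sigma]
  refine Finset.sum_congr rfl fun i _ => ?_
  rw [LinearMap.trace_eq_matrix_trace F (finBasis F (M i)), Matrix.trace]
  refine Finset.sum_congr rfl fun j _ => ?_
  simp [LinearMap.toMatrix_apply, Pi.basis_apply, Pi.basis_repr]

/-! ### Balancing the diagonal entries. -/

/-- Elements `x i`, `y i` with prescribed sums `x i + y i = d i` such that a value other than `0`
and `∑ i, d i` is taken equally often by `x` and by `y`. -/
theorem exists_add_eq_of_card_fiber_eq {F : Type*} [Field F] [CharP F 2] {m : ℕ} (d w : Fin m → F) :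
    ∃ x y : Fin m → F, (∀ i, x i + y i = d i) ∧ (∀ i, d i = 0 → x i = w i) ∧
      ∀ c, c ≠ 0 → c ≠ ∑ i, d i → Nonempty ({i // x i = c} ≃ {i // y i = c}) := by
  classical
  let D : ℕ → F := fun j => if h : j < m then d ⟨j, h⟩ else 0
  let S : ℕ → F := fun j => ∑ i ∈ Finset.range j, D i
  have hD : ∀ i : Fin m, D i = d i := fun i => by simp [D]
  have hS : ∀ i : Fin m, S (i + 1) = S i + d i := fun i => by
    simp only [S]
    rw [Finset.sum_range_succ, hD]
  have hSm : S m = ∑ i, d i := by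
    simp only [S]
    rw [Finset.sum_range]
    simp [hD]
  -- Consecutive partial sums add up to `d i` in characteristic 2, and their multiplicities
  -- telescope to the endpoints `S 0 = 0` and `S m`.
  refine ⟨fun i => if d i = 0 then w i else S i, fun i => if d i = 0 then w i else S (i + 1),
    fun i => ?_, fun i hi => by simp [hi], fun c hc0 hcm => ?_⟩
  · dsimp only
    split_ifs with h
    · rw [h, CharTwo.add_self_eq_zero]
    · rw [hS, ← add_assoc, CharTwo.add_self_eq_zero, zero_add]
  · have tele : ∑ i : Fin m,
        ((if S (i + 1) = c then 1 else 0 : ℤ) - if S i = c then 1 else 0) = 0 := by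
      rw [← Finset.sum_range fun i =>
          ((if S (i + 1) = c then 1 else 0 : ℤ) - if S i = c then 1 else 0),
        Finset.sum_range_sub fun i => (if S i = c then 1 else 0 : ℤ), hSm, if_neg hcm.symm]
      simp [S, hc0.symm]
    -- Where `d i = 0` one has `S (i + 1) = S i`, so replacing both by `w i` leaves the difference
    -- at zero.
    have hcount : ∑ i : Fin m, ((if (if d i = 0 then w i else S (i + 1)) = c then 1 else 0 : ℤ) -
        if (if d i = 0 then w i else S i) = c then 1 else 0) = 0 := by
      refine Eq.trans (Finset.sum_congr rfl fun i _ => ?_) tele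
      by_cases h : d i = 0
      · rw [hS]
        simp [h]
      · simp only [if_neg h]
    rw [Finset.sum_sub_distrib, sub_eq_zero, Finset.sum_boole, Finset.sum_boole] at hcount
    refine ⟨Fintype.equivOfCardEq ?_⟩
    rw [Fintype.card_subtype, Fintype.card_subtype]
    exact_mod_cast hcount.symm

/-- A finite family of diagonal blocks together with an infinite-dimensional zero operator. -/
theorem exists_three_sq_zero_of_pi_prod {F Z : Type*} [Field F] [CharP F 2] [AddCommGroup Z]
    [Module F Z] (hZ : ¬ FiniteDimensional F Z) {m : ℕ} {N : Fin m → Type*}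
    [∀ i, AddCommGroup (N i)] [∀ i, Module F (N i)] {u : ∀ i, Module.End F (N i)}
    {x y : Fin m → F} (h : ∀ i, HasDiagonalBlocks (u i) (x i) (y i)) (α : F)
    (hxy : ∀ c, c ≠ 0 → c ≠ α → Nonempty ({i // x i = c} ≃ {i // y i = c})) :
    ∃ a a' c : Module.End F ((∀ i, N i) × Z), a ^ 2 = 0 ∧ a' ^ 2 = 0 ∧ c ^ 2 = 0 ∧
      α • LinearMap.id + LinearMap.prodMap (LinearMap.pi fun i => u i ∘ₗ LinearMap.proj i) 0 =
        a + a' + c := by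
  choose n b χ μ k l hb hk hl hx hy h0 using h
  let bZ := Basis.ofVectorSpace F Z
  set ζ := Basis.ofVectorSpaceIndex F Z
  have hζ : Infinite ζ := by
    rw [← not_finite_iff_infinite]
    intro hfin
    exact hZ bZ.finiteDimensional_of_finite
  -- Half of the basis of `Z` goes to each class, giving both the same infinite supply of zero
  -- entries.
  obtain ⟨e⟩ : Nonempty (ζ ≃ ζ ⊕ ζ) := by
    rw [← Cardinal.eq, Cardinal.mk_sum, Cardinal.lift_id,
      Cardinal.add_eq_self (Cardinal.aleph0_le_mk ζ)]
  have hB := (IsBlockDiagonalBasis.pi hb).prodMap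
    (isBlockDiagonalBasis_zero (bZ.reindex e) (Sum.elim (fun _ => true) fun _ => false))
  refine exists_three_sq_zero_of_equiv hB α fun c hcα => ?_
  by_cases hc : c = 0
  · subst hc
    set ι := (Σ i, Fin (n i)) ⊕ (ζ ⊕ ζ)
    have hι : Cardinal.mk ι ≤ Cardinal.mk ζ := by
      have h1 : Cardinal.mk (Σ i, Fin (n i)) ≤ Cardinal.aleph0 := Cardinal.mk_le_aleph0
      have h2 := Cardinal.aleph0_le_mk ζ
      simp only [ι, Cardinal.mk_sum, Cardinal.lift_id, Cardinal.lift_uzero]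
      rw [Cardinal.add_eq_self h2]
      refine Cardinal.add_le_of_le h2 ?_ le_rfl
      exact (Cardinal.lift_le.mpr h1).trans (by simp)
    rw [← Cardinal.eq]
    refine le_antisymm ?_ ?_
    · refine (Cardinal.mk_subtype_le _).trans (hι.trans ?_)
      exact Cardinal.mk_le_of_injective (f := fun z => ⟨Sum.inr (Sum.inr z), rfl, rfl⟩)
        fun z z' hz => by simpa using hz
    · refine (Cardinal.mk_subtype_le _).trans (hι.trans ?_)
      exact Cardinal.mk_le_of_injective (f := fun z => ⟨Sum.inr (Sum.inl z), rfl, rfl⟩)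
        fun z z' hz => by simpa using hz
  · obtain ⟨e'⟩ := hxy c hc hcα
    -- A nonzero value `c` occurs only at the marked indices `k i` and `l i`, so its occurrences are
    -- counted by `x` and `y`.
    have key : ∀ (t : Bool) (q : ∀ i, Fin (n i)) (z : Fin m → F) (hqt : ∀ i, χ i (q i) = t)
        (hqz : ∀ i, μ i (q i) = z i), (∀ i j, χ i j = t → j ≠ q i → μ i j = 0) →
        Function.Bijective (fun i : {i // z i = c} =>
          (⟨Sum.inl ⟨i.1, q i.1⟩, hqt i.1, (hqz i.1).trans i.2⟩ :
            {i : (Σ i, Fin (n i)) ⊕ (ζ ⊕ ζ) // Sum.elim (fun p => χ p.1 p.2)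
              (Sum.elim (fun _ => true) fun _ => false) i = t ∧
                Sum.elim (fun p => μ p.1 p.2) 0 i = c})) := by
      intro t q z hqt hqz hq
      constructor
      · rintro ⟨i, hi⟩ ⟨j, hj⟩ hij
        simp only [Subtype.mk.injEq, Sum.inl.injEq, Sigma.mk.injEq] at hij
        exact Subtype.ext hij.1
      · rintro ⟨⟨i, j⟩ | s, hi, hc'⟩
        · simp only [Sum.elim_inl] at hi hc'
          have hj : j = q i := by
            by_contra hj
            exact hc (hc'.symm.trans (hq i j hi hj))
          subst hj
          exact ⟨⟨i, (hqz i).symm.trans hc'⟩, rfl⟩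
        · exact absurd hc'.symm hc
    refine ⟨((Equiv.ofBijective _ (key true k x hk hx ?_)).symm.trans e').trans
      (Equiv.ofBijective _ (key false l y hl hy ?_))⟩
    · intro i j hj hjk
      refine h0 i j hjk ?_
      rintro rfl
      simp [hl] at hj
    · intro i j hj hjl
      refine h0 i j ?_ hjl
      rintro rfl
      simp [hk] at hj

/-! ### Splitting off the zero part and assembling. -/

theorem exists_linearEquiv_prod_of_not_finiteDimensional {F Z P : Type*} [Field F] [AddCommGroup Z]
    [Module F Z] [AddCommGroup P] [Module F P] [FiniteDimensional F P]
    (hZ : ¬ FiniteDimensional F Z) : Nonempty (Z ≃ₗ[F] P × Z) := by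
  have h1 : Cardinal.aleph0 ≤ Module.rank F Z := by
    rw [← not_lt, Module.rank_lt_aleph0_iff]
    exact hZ
  rw [Module.nonempty_linearEquiv_iff_lift_rank_eq, rank_prod, Cardinal.lift_add,
    Cardinal.lift_lift, Cardinal.lift_lift, Cardinal.lift_umax]
  symm
  refine (Cardinal.add_eq_right ?_ ?_).trans ?_
  · simpa using h1
  · refine le_trans ?_ (b := Cardinal.aleph0) ?_
    · simpa using (Module.rank_lt_aleph0 F P).le
    · simpa using h1
  · rfl

theorem exists_three_sq_zero_conj {F V V' : Type*} [Field F] [AddCommGroup V] [Module F V]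
    [AddCommGroup V'] [Module F V'] (e : V ≃ₗ[F] V') {A : Module.End F V} {A' : Module.End F V'}
    (hA : ∀ v, e (A v) = A' (e v))
    (h : ∃ a b c : Module.End F V', a ^ 2 = 0 ∧ b ^ 2 = 0 ∧ c ^ 2 = 0 ∧ A' = a + b + c) :
    ∃ a b c : Module.End F V, a ^ 2 = 0 ∧ b ^ 2 = 0 ∧ c ^ 2 = 0 ∧ A = a + b + c := by
  obtain ⟨a, b, c, ha, hb, hc, habc⟩ := h
  have sq : ∀ s : Module.End F V', s ^ 2 = 0 → e.symm.conjRingEquiv s ^ 2 = 0 := fun s hs => by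
    rw [← map_pow, hs, map_zero]
  refine ⟨_, _, _, sq a ha, sq b hb, sq c hc, ?_⟩
  rw [← map_add, ← map_add, ← habc]
  ext v
  simp [LinearEquiv.conjRingEquiv, ← hA]

/-- Take `W` spanned by the range and a complement of the kernel, and `Z` a complement of `W ⊓ ker
u` within the kernel. -/
theorem exists_finiteDimensional_isCompl {F V : Type*} [Field F] [AddCommGroup V] [Module F V]
    (u : Module.End F V) [FiniteDimensional F (LinearMap.range u)] :
    ∃ W Z : Submodule F V, FiniteDimensional F W ∧ IsCompl W Z ∧ LinearMap.range u ≤ W ∧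
      Z ≤ LinearMap.ker u := by
  obtain ⟨C, hC⟩ := (LinearMap.ker u).exists_isCompl
  have hCfin : FiniteDimensional F C :=
    Module.Finite.equiv ((u.quotKerEquivRange.symm.trans
      (Submodule.quotientEquivOfIsCompl _ _ hC)) : LinearMap.range u ≃ₗ[F] C)
  let W := LinearMap.range u ⊔ C
  obtain ⟨Z', hZ'⟩ := (W ⊓ LinearMap.ker u).exists_isCompl
  refine ⟨W, Z' ⊓ LinearMap.ker u, inferInstance, ⟨?_, ?_⟩, le_sup_left, inf_le_right⟩
  · rw [disjoint_iff, ← hZ'.inf_eq_bot]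
    ac_rfl
  · rw [codisjoint_iff, eq_top_iff, ← hC.sup_eq_top, sup_le_iff]
    constructor
    · have : LinearMap.ker u = (W ⊓ LinearMap.ker u) ⊔ (Z' ⊓ LinearMap.ker u) := by
        rw [← sup_inf_assoc_of_le _ inf_le_right, hZ'.sup_eq_top, top_inf_eq]
      exact this.le.trans (sup_le_sup_right inf_le_left _)
    · exact le_sup_right.trans le_sup_left

theorem mainTheorem7 {F V : Type*} [Field F] [CharP F 2] [AddCommGroup V] [Module F V]
    (hV : ¬ FiniteDimensional F V) (α : F) (u : Module.End F V)
    (hu : FiniteDimensional F (LinearMap.range u))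
    (htr : finiteRankTrace u = 0 ∨ finiteRankTrace u = α) :
    ∃ a b c : Module.End F V,
      a ^ 2 = 0 ∧ b ^ 2 = 0 ∧ c ^ 2 = 0 ∧ α • LinearMap.id + u = a + b + c := by
  obtain ⟨W, Z, hWfin, hWZ, hrange, hker⟩ := exists_finiteDimensional_isCompl u
  have hZ : ¬ FiniteDimensional F Z := fun _ =>
    hV (Module.Finite.equiv (Submodule.prodEquivOfIsCompl W Z hWZ))
  let T : Module.End F W := u.restrict (p := W) (q := W)
    fun x _ => hrange (LinearMap.mem_range_self u x)
  have hT : finiteRankTrace u = LinearMap.trace F W T :=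
    finiteRankTrace_eq_trace_restrict u W hrange
  obtain ⟨m, f, hf, e, he⟩ := exists_linearEquiv_pi_adjoinRoot T
  have hfin : ∀ i, FiniteDimensional F (AdjoinRoot (f i)) := fun i =>
    (AdjoinRoot.powerBasis (hf i)).finite
  let r : ∀ i, Module.End F (AdjoinRoot (f i)) := fun i =>
    LinearMap.mulLeft F (AdjoinRoot.root (f i))
  have htrace : finiteRankTrace u = ∑ i, LinearMap.trace F _ (r i) := by
    rw [hT, ← LinearMap.trace_pi_comp_proj, ← LinearMap.trace_conj' T e]
    congr 1
    refine LinearMap.ext fun v => funext fun i => ?_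
    simp [LinearEquiv.conj_apply, he, r]
  have hblock : ∀ i, ∃ w : F, ∀ x y : F, x + y = LinearMap.trace F _ (r i) →
      (LinearMap.trace F _ (r i) = 0 → x = w) →
      HasDiagonalBlocks (LinearMap.prodMap (r i) (0 : Module.End F (F × F))) x y := fun i => by
    obtain ⟨b, hb⟩ := AdjoinRoot.exists_basis_cyclic (hf i)
    exact exists_hasDiagonalBlocks_of_cyclic b hb
  choose w hw using hblock
  obtain ⟨x, y, hxy, hx, hcard⟩ :=
    exists_add_eq_of_card_fiber_eq (fun i => LinearMap.trace F _ (r i)) w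
  have hmain := exists_three_sq_zero_of_pi_prod hZ (fun i => hw i _ _ (hxy i) (hx i)) α
    fun c hc0 hcα => hcard c hc0 (by rcases htr with h | h <;> simp [← htrace, h, hc0, hcα])
  -- `Z` lends each cyclic block its two extra zero dimensions and stays the same up to isomorphism.
  obtain ⟨g⟩ := exists_linearEquiv_prod_of_not_finiteDimensional (P := Fin m → F × F) hZ
  let e1 : (W × Z) ≃ₗ[F] (∀ i, AdjoinRoot (f i) × (F × F)) × Z :=
    (e.prodCongr g).trans ((LinearEquiv.prodAssoc F _ _ _).symm.trans
      (LinearEquiv.prodCongr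
        { toFun := fun p i => (p.1 i, p.2 i)
          invFun := fun q => (fun i => (q i).1, fun i => (q i).2)
          map_add' := fun _ _ => rfl
          map_smul' := fun _ _ => rfl
          left_inv := fun _ => rfl
          right_inv := fun _ => rfl } (LinearEquiv.refl F Z)))
  refine exists_three_sq_zero_conj ((Submodule.prodEquivOfIsCompl W Z hWZ).symm.trans e1) ?_ hmain
  intro v
  obtain ⟨⟨a, z⟩, rfl⟩ := (Submodule.prodEquivOfIsCompl W Z hWZ).surjective v
  have hua : u (Submodule.prodEquivOfIsCompl W Z hWZ (a, z)) =
      Submodule.prodEquivOfIsCompl W Z hWZ (T a, 0) := by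
    have : u (z : V) = 0 := hker z.2
    simp [this, T]
  simp only [LinearMap.add_apply, LinearMap.smul_apply, LinearMap.id_apply, map_add, map_smul, hua,
    LinearEquiv.trans_apply, LinearEquiv.symm_apply_apply]
  congr 1
  refine Prod.ext ?_ ?_
  · funext i
    change (e (T a) i, (g 0).1 i) = (AdjoinRoot.root (f i) * e a i, (0 : F × F))
    simp [he]
  · change (g 0).2 = 0
    simp
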